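/- Let $G$ be a finite imperfect-information extensive-form game (EFG) with a finite player set $N$, $n=|N|$, terminal histories $Z$ and utilities $u_i$, in which all players have perfect recall. Let $\Pi_i$ be the set of behavior strategies of player $i$, $\Pi=\prod_i\Pi_i$, and write $u_i(\pi)$ for expected utility; $p_i(h,\pi_i)$ is the product of the probabilities that $\pi_i$ gives to the actions of $i$ on the path to $h$. A *poly-EFG* $\check G$ on the form of $G$ consists of a graph $(N,E)$ and, for every edge $\{i,j\}\in E$, a two-player game $\check G_{ij}$ with the same histories and information sets as $G$, in which $i$ and $j$ act where they act in $G$ and chance acts, by some strategy $\pi_c^{ij}$, at all other non-terminal histories, with utilities $\check u_{ij},\check u_{ji}:Z\to\mathbb R$. Put $\check u_{ij}(\pi_i,\pi_j)=\sum_{z\in Z}p_i(z,\pi_i)\,p_j(z,\pi_j)\,p_c(z,\pi_c^{ij})\,\check u_{ij}(z)$ and $\check u_i(\pi)=\sum_{j:\{i,j\}\in E}\check u_{ij}(\pi_i,\pi_j)$. It is *constant-sum* if for every edge there is a constant $c_{ij}$ with $\check u_{ij}(z)+\check u_{ji}(z)=c_{ij}$ for all $z\in Z$. Let $\mathrm{CSP}_\delta(G)$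 be the set of constant-sum poly-EFGs $\check G$ on the form of $G$ with $|u_i(\pi)-\check u_i(\pi)|\le\delta$ for all $i\in N$, $\pi\in\Pi$; $G$ is $\delta$-CSP if this set is nonempty. A poly-EFG $\check G$ is *$(\epsilon,\gamma)$-subgame stable* if for every $\epsilon$-Nash equilibrium $\pi\in\Pi$ of $\check G$ and every edge $\{i,j\}$, $(\pi_i,\pi_j)$ is a $\gamma$-Nash equilibrium of $\check G_{ij}$. Let $\mu$ be a (normal-form) coarse correlated equilibrium of $G$, that is, a probability distribution on pure strategy profiles such that no player gains in expectation by deviating to a fixed pure strategy. A *marginal behavior strategy profile* of $\mu$ is any $\pi^\mu\in\Pi$ such that, for every player $i$, every information set $I$ of $i$ and every action $a$ available at $I$, $$\pi_i^\mu(a,I)=\frac{\sum_{\rho_i\in P_i(a,I)}s_i^\mu(\rho_i)}{\sum_{\rho_i\in P_i(I)}s_i^\mu(\rho_i)}$$ whenever the denominator is nonzero ($\pi_i^\mu(\cdot,I)$ is arbitrary otherwise). Here $s_i^\mu$ is the marginal of $\mu$ on the pure strategies of $i$, $P_i(I)$ is the set of pure strategies of $i$ that choose all actions of $i$ on the path to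 some history in $I$, and $P_i(a,I)$ is the set of those that moreover choose $a$ at $I$. **Proposition.** Suppose that $G$ is $\delta$-CSP and that some $\check G\in\mathrm{CSP}_\delta(G)$ is $(2n\delta,\gamma)$-subgame stable. Then for every coarse correlated equilibrium $\mu$ of $G$, every marginal behavior strategy profile $\pi^\mu$ of $\mu$ and every player $i$, $$\mathrm{Vul}_i(\pi^\mu,\Pi_{-i}):=u_i(\pi^\mu)-\min_{\pi'_{-i}\in\Pi_{-i}}u_i(\pi^\mu_i,\pi'_{-i})\;\le\;|E_i|\gamma+2\delta,$$ where $E_i\subseteq E$ is the set of edges of $\check G$ at $i$. If moreover $\gamma\ge 0$, then $|E_i|\gamma+2\delta\le(n-1)\gamma+2\delta$. -/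

import Mathlib

open scoped Classical

/-- A finite game tree: a finite prefix-closed set of histories (finite sequences of actions) that
contains the empty history, and a player function; `none` is the chance player. Only the values of
`player` at non-terminal histories matter. -/
structure GameTree (N A : Type*) where
  hist : Finset (List A)
  nil_mem : [] ∈ hist
  prefix_closed : ∀ (h : List A) (a : A), h ++ [a] ∈ hist → h ∈ hist
  player : List A → Option N

namespace GameTree

variable {N A : Type*} (T : GameTree N A)

/-- The actions available after the history `h`. -/
abbrev Avail (h : List A) : Type _ := {a : A // h ++ [a] ∈ T.hist}

/-- Non-terminal histories. -/
abbrev Nonterminal : Type _ := {h : List A // ∃ a, h ++ [a] ∈ T.hist}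

/-- Terminal histories. -/
abbrev Terminal : Type _ := {h : List A // h ∈ T.hist ∧ ∀ a, h ++ [a] ∉ T.hist}

/-- Non-terminal histories at which player `i` acts. -/
abbrev Decision (i : N) : Type _ :=
  {h : List A // (∃ a, h ++ [a] ∈ T.hist) ∧ T.player h = some i}

instance (h : List A) : Finite (T.Avail h) :=
  Finite.of_injective (fun a : T.Avail h => (⟨h ++ [a.1], a.2⟩ : {l // l ∈ T.hist}))
    (fun a b hab => by
      have := congrArg Subtype.val hab
      simpa [Subtype.ext_iff] using this)

noncomputable instance (h : List A) : Fintype (T.Avail h) := Fintype.ofFinite _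

instance : Finite T.Terminal :=
  Finite.of_injective (fun z : T.Terminal => (⟨z.1, z.2.1⟩ : {l // l ∈ T.hist}))
    (fun a b hab => by simpa [Subtype.ext_iff] using hab)

noncomputable instance : Fintype T.Terminal := Fintype.ofFinite _

instance (i : N) : Finite (T.Decision i) :=
  Finite.of_injective
    (fun d : T.Decision i =>
      (⟨d.1, d.2.1.elim fun a ha => T.prefix_closed _ a ha⟩ : {l // l ∈ T.hist}))
    (fun a b hab => by simpa [Subtype.ext_iff] using hab)

/-- A behavior of chance: a probability distribution over the available actions at every
non-terminal history. It is used only at the histories that belong to chance in the game under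
consideration; its values elsewhere are irrelevant. -/
abbrev ChanceStrategy : Type _ := ∀ h : T.Nonterminal, stdSimplex ℝ (T.Avail h.1)

variable {T} in
/-- The probability that chance plays `a` after `h`. -/
noncomputable def ChanceStrategy.prob (κ : T.ChanceStrategy) (h : List A) (a : A) : ℝ :=
  if ha : h ++ [a] ∈ T.hist then (κ ⟨h, a, ha⟩).1 ⟨a, ha⟩ else 0

/-- The product of `f h' a` over all `h' ++ [a]` that are prefixes of `h` and such that the player
who acts at `h'` lies in `S`. -/
noncomputable def pathProb (S : Set (Option N)) (f : List A → A → ℝ) (h : List A) : ℝ :=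
  ∏ k : Fin h.length, if T.player (h.take k) ∈ S then f (h.take k) (h.get k) else 1

end GameTree

/-- A game tree with, for every player `i`, a partition (as an equivalence relation) of the
histories at which `i` acts into information sets; the same actions are available at all histories
of an information set. -/
structure GameForm (N A : Type*) extends GameTree N A where
  info : ∀ i : N, Setoid (toGameTree.Decision i)
  info_avail : ∀ (i : N) (d d' : toGameTree.Decision i), (info i).r d d' →
    ∀ a, d.1 ++ [a] ∈ hist ↔ d'.1 ++ [a] ∈ hist

namespace GameForm

variable {N A : Type*} (F : GameForm N A)

/-- The information sets of player `i`. -/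
abbrev InfoSet (i : N) : Type _ := Quotient (F.info i)

/-- The information set that contains a history at which `i` acts. -/
def infoOf {i : N} (d : F.Decision i) : F.InfoSet i := Quotient.mk (F.info i) d

variable {F} in
/-- The actions available at an information set. -/
abbrev ActionsAt {i : N} (I : F.InfoSet i) : Type _ :=
  {a : A // ∃ d : F.Decision i, F.infoOf d = I ∧ d.1 ++ [a] ∈ F.hist}

instance {i : N} (I : F.InfoSet i) : Finite (ActionsAt I) := by
  obtain ⟨d₀, rfl⟩ := Quotient.exists_rep I
  refine Finite.of_injective
    (fun a : ActionsAt (Quotient.mk (F.info i) d₀) => (⟨a.1, ?_⟩ : F.Avail d₀.1)) ?_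
  · obtain ⟨a, d, hd, ha⟩ := a
    exact (F.info_avail i d d₀ (Quotient.exact hd) a).1 ha
  · intro a b hab
    simpa [Subtype.ext_iff] using hab

noncomputable instance {i : N} (I : F.InfoSet i) : Fintype (ActionsAt I) := Fintype.ofFinite _

/-- A pure strategy: a choice of an available action at every information set. -/
abbrev PureStrategy (i : N) : Type _ := ∀ I : F.InfoSet i, ActionsAt I

noncomputable instance (i : N) : Fintype (F.PureStrategy i) := Fintype.ofFinite _

/-- Pure strategy profiles. -/
abbrev PureProfile : Type _ := ∀ i : N, F.PureStrategy i

/-- A behavior strategy: a probability distribution over the available actions at every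
information set. -/
abbrev BehaviorStrategy (i : N) : Type _ := ∀ I : F.InfoSet i, stdSimplex ℝ (ActionsAt I)

/-- Behavior strategy profiles. -/
abbrev BehaviorProfile : Type _ := ∀ i : N, F.BehaviorStrategy i

variable {F} in
/-- A pure strategy as a (degenerate) behavior strategy. -/
noncomputable def PureStrategy.toBehavior {i : N} (ρ : F.PureStrategy i) : F.BehaviorStrategy i :=
  fun I => ⟨Pi.single (ρ I) 1, single_mem_stdSimplex ℝ (ρ I)⟩

variable {F} in
/-- A pure strategy profile as a behavior strategy profile. -/
noncomputable def PureProfile.toBehavior (ρ : F.PureProfile) : F.BehaviorProfile :=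
  fun i => PureStrategy.toBehavior (ρ i)

variable {F} in
/-- The probability that player `i` plays `a` after the history `h` (at which `i` acts). -/
noncomputable def BehaviorStrategy.prob {i : N} (σ : F.BehaviorStrategy i)
    (h : List A) (a : A) : ℝ :=
  if ha : h ++ [a] ∈ F.hist ∧ F.player h = some i then
    (σ (F.infoOf ⟨h, ⟨a, ha.1⟩, ha.2⟩)).1 ⟨a, ⟨h, ⟨a, ha.1⟩, ha.2⟩, rfl, ha.1⟩
  else 0

variable {F} in
/-- The contribution of player `i` to the probability of reaching the history `h`. -/
noncomputable def BehaviorStrategy.reach {i : N} (σ : F.BehaviorStrategy i) (h : List A) : ℝ :=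
  F.pathProb {some i} (BehaviorStrategy.prob σ) h

/-- What player `i` has observed of his own play before the history `h`: the pairs of an own
information set passed on the way to `h` and the action taken there. -/
def ownPast (i : N) (h : List A) : Set (F.InfoSet i × A) :=
  {x | ∃ d : F.Decision i, F.infoOf d = x.1 ∧ (d.1 ++ [x.2]) <+: h}

/-- Perfect recall of all players. -/
def PerfectRecall : Prop :=
  ∀ (i : N) (d d' : F.Decision i), F.infoOf d = F.infoOf d' → F.ownPast i d.1 = F.ownPast i d'.1

variable {F} in
/-- The pure strategies of player `i` that play to the information set `I`, that is, choose all the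
actions of `i` that lead to some history of `I`. -/
noncomputable def playTo {i : N} (I : F.InfoSet i) : Finset (F.PureStrategy i) :=
  {ρ | ∃ d : F.Decision i, F.infoOf d = I ∧
    BehaviorStrategy.reach (PureStrategy.toBehavior ρ) d.1 = 1}

variable {F} in
/-- The pure strategies of player `i` that play to `I` and choose `a` there. -/
noncomputable def playToAction {i : N} (I : F.InfoSet i) (a : ActionsAt I) :
    Finset (F.PureStrategy i) :=
  {ρ ∈ playTo I | ρ I = a}

section Mu

variable [Fintype N] [DecidableEq N]

variable {F} in
/-- The marginal mixed strategy of player `i` under a distribution over pure profiles. -/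
noncomputable def marginal (μ : F.PureProfile → ℝ) (i : N) (ρi : F.PureStrategy i) : ℝ :=
  ∑ ρ : F.PureProfile with ρ i = ρi, μ ρ

variable {F} in
/-- `π` is a marginal behavior strategy profile of `μ`: at every information set `I` that is played
to with positive marginal probability, the probability of `a` is the conditional probability of
choosing `a` at `I` given that `I` is played to. At the other information sets `π` is arbitrary. -/
def IsMarginalBehavior (μ : F.PureProfile → ℝ) (π : F.BehaviorProfile) : Prop :=
  ∀ (i : N) (I : F.InfoSet i), ∑ ρi ∈ playTo I, marginal μ i ρi ≠ 0 →
    ∀ a : ActionsAt I, (π i I).1 a =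
      (∑ ρi ∈ playToAction I a, marginal μ i ρi) / ∑ ρi ∈ playTo I, marginal μ i ρi

end Mu

end GameForm

/-- A finite extensive-form game with imperfect information. -/
structure EFG (N A : Type*) extends GameForm N A where
  chance : toGameTree.ChanceStrategy
  utility : N → toGameTree.Terminal → ℝ

namespace EFG

variable {N A : Type*} [Fintype N] [DecidableEq N] (G : EFG N A)

/-- Expected utility of player `i` under a behavior strategy profile. -/
noncomputable def expUtility (i : N) (π : G.BehaviorProfile) : ℝ :=
  ∑ z : G.Terminal,
    ((∏ j, GameForm.BehaviorStrategy.reach (π j) z.1) *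
      G.pathProb {none} (GameTree.ChanceStrategy.prob G.chance) z.1) * G.utility i z

/-- A (normal-form) coarse correlated equilibrium: a distribution over pure strategy profiles from
which no player gains in expectation by deviating to a fixed pure strategy. -/
def IsCCE (μ : G.PureProfile → ℝ) : Prop :=
  μ ∈ stdSimplex ℝ G.PureProfile ∧
  ∀ (i : N) (ρi' : G.PureStrategy i),
    ∑ ρ : G.PureProfile, μ ρ *
      (G.expUtility i (GameForm.PureProfile.toBehavior (Function.update ρ i ρi')) -
        G.expUtility i (GameForm.PureProfile.toBehavior ρ)) ≤ 0

/-- The payoffs of player `i` when `i` plays as in `π` and the other players play as in some profile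
of `S`. Profiles of the other players are written as full profiles whose `i`-th entry is
overwritten. -/
def payoffsAgainst (i : N) (π : G.BehaviorProfile) (S : Set G.BehaviorProfile) : Set ℝ :=
  (fun π' => G.expUtility i (Function.update π' i (π i))) '' S

/-- The vulnerability of `π` for player `i` with respect to the opponents' profiles in `S`. -/
noncomputable def vulnerability (i : N) (π : G.BehaviorProfile) (S : Set G.BehaviorProfile) : ℝ :=
  G.expUtility i π - sInf (G.payoffsAgainst i π S)

/-- Expected utility is continuous in the behavior strategy profile. -/
theorem continuous_expUtility (i : N) : Continuous (G.expUtility i) := by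
  unfold EFG.expUtility
  refine continuous_finsetSum _ fun z _ => ?_
  refine Continuous.mul (Continuous.mul ?_ continuous_const) continuous_const
  refine continuous_finsetProd _ fun j _ => ?_
  unfold GameForm.BehaviorStrategy.reach GameTree.pathProb
  refine continuous_finsetProd _ fun k _ => ?_
  split_ifs
  · unfold GameForm.BehaviorStrategy.prob
    split_ifs
    · exact (continuous_apply _).comp
        (continuous_subtype_val.comp ((continuous_apply _).comp (continuous_apply j)))
    · exact continuous_const
  · exact continuous_const

/-- Against the set of all opponents' profiles the infimum in the vulnerability is a minimum. -/
theorem isLeast_sInf_payoffsAgainst (i : N) (π : G.BehaviorProfile) :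
    IsLeast (G.payoffsAgainst i π Set.univ) (sInf (G.payoffsAgainst i π Set.univ)) := by
  have hc : IsCompact (G.payoffsAgainst i π Set.univ) := by
    have : ∀ (j : N) (I : G.InfoSet j), CompactSpace (stdSimplex ℝ (GameForm.ActionsAt I)) :=
      fun j I => isCompact_iff_compactSpace.1 (isCompact_stdSimplex ℝ _)
    exact isCompact_univ.image
      ((G.continuous_expUtility i).comp (continuous_id.update i continuous_const))
  exact hc.isLeast_sInf ⟨_, π, Set.mem_univ π, rfl⟩

end EFG

/-- A poly-EFG over the game form `F`: a graph on the players and, for every edge `{i, j}`, a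
two-player game with the histories and the information sets of `F`, in which `i` and `j` act where
they act in `F` and chance acts at all other non-terminal histories. The game on `{i, j}` has its own
chance strategy `chance s(i, j)` and the utilities `utility i j` of `i` and `utility j i` of `j`;
values for pairs that are not edges are irrelevant. -/
structure PolyEFG {N A : Type*} (F : GameForm N A) where
  graph : SimpleGraph N
  chance : Sym2 N → F.ChanceStrategy
  utility : N → N → F.Terminal → ℝ

namespace PolyEFG

variable {N A : Type*} {F : GameForm N A} (P : PolyEFG F)

/-- Expected utility of player `i` in the game on the edge `{i, j}`. -/
noncomputable def edgeUtility (i j : N) (σ : F.BehaviorStrategy i) (τ : F.BehaviorStrategy j) : ℝ :=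
  ∑ z : F.Terminal,
    GameForm.BehaviorStrategy.reach σ z.1 * GameForm.BehaviorStrategy.reach τ z.1 *
      F.pathProb {some i, some j}ᶜ (GameTree.ChanceStrategy.prob (P.chance s(i, j))) z.1 *
      P.utility i j z

/-- Global expected utility of player `i`: the sum over the edges at `i`. -/
noncomputable def expUtility [Fintype N] (i : N) (π : F.BehaviorProfile) : ℝ :=
  ∑ j with P.graph.Adj i j, P.edgeUtility i j (π i) (π j)

/-- The number of edges at `i`. -/
noncomputable def numEdges (i : N) : ℕ := (P.graph.incidenceSet i).ncard

/-- Each edge game is constant-sum at its terminal histories; the constant may depend on the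
edge. -/
def IsConstantSum : Prop :=
  ∀ i j, P.graph.Adj i j → ∃ c : ℝ, ∀ z, P.utility i j z + P.utility j i z = c

/-- `ε`-Nash equilibria of a poly-EFG in behavior strategies. -/
def IsNash [Fintype N] [DecidableEq N] (ε : ℝ) (π : F.BehaviorProfile) : Prop :=
  ∀ (i : N) (σ : F.BehaviorStrategy i),
    P.expUtility i (Function.update π i σ) - P.expUtility i π ≤ ε

/-- `(σ, τ)` is a `γ`-Nash equilibrium of the two-player game on the edge `{i, j}`. -/
def IsEdgeNash (γ : ℝ) (i j : N) (σ : F.BehaviorStrategy i) (τ : F.BehaviorStrategy j) : Prop :=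
  (∀ σ' : F.BehaviorStrategy i, P.edgeUtility i j σ' τ - P.edgeUtility i j σ τ ≤ γ) ∧
  (∀ τ' : F.BehaviorStrategy j, P.edgeUtility j i τ' σ - P.edgeUtility j i τ σ ≤ γ)

/-- `γ`-subgame stable profiles. -/
def IsStableProfile (γ : ℝ) (π : F.BehaviorProfile) : Prop :=
  ∀ i j, P.graph.Adj i j → P.IsEdgeNash γ i j (π i) (π j)

/-- `(ε, γ)`-subgame stable poly-EFGs. -/
def IsSubgameStable [Fintype N] [DecidableEq N] (ε γ : ℝ) : Prop :=
  ∀ π : F.BehaviorProfile, P.IsNash ε π → P.IsStableProfile γ π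

end PolyEFG

/-- The constant-sum poly-EFGs on the form of `G` whose global utilities are within `δ` of those of
`G` at every behavior strategy profile. The game `G` is `δ`-CSP if this set is nonempty. -/
def EFG.CSP {N A : Type*} [Fintype N] [DecidableEq N] (G : EFG N A) (δ : ℝ) :
    Set (PolyEFG G.toGameForm) :=
  {P | P.IsConstantSum ∧
    ∀ (i : N) (π : G.BehaviorProfile), |G.expUtility i π - P.expUtility i π| ≤ δ}

/-!
The marginal profile `π` of a coarse correlated equilibrium `μ` turns out to be a `2nδ`-Nash
equilibrium of the constant-sum polymatrix game `P`; the rest is subgame stability.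

The utility of player `i` in `P` is a sum over edges, and on every edge it is linear in the reach
probabilities of the opponent. By Kuhn's theorem (`IsMarginalBehavior.reach_eq`) these are the same
under `π j` as under the marginal of `μ`, so against `π` a deviation of `i` is worth as much as
against `μ`, although `μ` may correlate the opponents
(`PolyEFG.expUtility_update_eq_sum_profile`). A behavior strategy is, again by Kuhn's theorem, a
mixture of pure strategies (`BehaviorStrategy.sum_mixed_mul_reach`), hence the equilibrium condition
and `δ`-closeness bound the utility of every deviation by `E_μ [P-utility of i] + 2δ`
(`EFG.IsCCE.expUtility_update_le`). In particular this bounds the utility of `π` itself, for every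
player. As the utilities of all players add up to the same constant under `π` and under `μ`, the
utility of `i` under `π` is at least `E_μ [P-utility of i] - 2(n-1)δ`, and no deviation of `i` gains
more than `2nδ` (`EFG.IsCCE.isNash`).

Stability makes `(π i, π j)` a `γ`-Nash equilibrium of every edge game. Since an edge game has a
constant sum, a change of strategy of `j` costs `i` what it gains `j`, which is at most `γ`
(`PolyEFG.IsStableProfile.expUtility_sub_le`). Passing between `G` and `P` costs another `2δ`.
-/

/-! ### Path probabilities -/

namespace GameTree

variable {N A : Type*} (T : GameTree N A)

theorem pathProb_nil (S : Set (Option N)) (f : List A → A → ℝ) : T.pathProb S f [] = 1 :=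
  Fin.prod_univ_zero _

theorem pathProb_append_singleton (S : Set (Option N)) (f : List A → A → ℝ) (h : List A) (a : A) :
    T.pathProb S f (h ++ [a]) = T.pathProb S f h * if T.player h ∈ S then f h a else 1 := by
  unfold pathProb
  have hl : h.length + 1 = (h ++ [a]).length := by simp
  rw [← Fin.prod_congr' _ hl, Fin.prod_univ_castSucc]
  congr 1
  · refine Finset.prod_congr rfl fun k _ => ?_
    have hk := k.2
    simp [List.take_append_of_le_length hk.le, List.getElem_append_left hk]
  · simp

/-- Every nonempty history contributes its weight to the parent history, so the weights of the
non-terminal histories add up to those of all histories but the empty one; hence the weights of the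
terminal histories add up to the weight of the empty history. -/
theorem sum_terminal_pathProb (f : List A → A → ℝ)
    (hf : ∀ h, (∃ a, h ++ [a] ∈ T.hist) → ∑ a : T.Avail h, f h a.1 = 1) :
    ∑ z : T.Terminal, T.pathProb Set.univ f z.1 = 1 := by
  set W := T.pathProb Set.univ f
  have hW : ∀ h a, W (h ++ [a]) = W h * f h a := fun h a => by
    simp [W, pathProb_append_singleton]
  have hnon : ∑ h ∈ T.hist with ∃ a, h ++ [a] ∈ T.hist, W h = ∑ h ∈ T.hist.erase [], W h := by
    rw [← Finset.sum_fiberwise_of_maps_to (s := T.hist.erase [])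
      (t := T.hist.filter fun h => ∃ a, h ++ [a] ∈ T.hist) (g := List.dropLast)]
    · refine Finset.sum_congr rfl fun h hh => ?_
      rw [Finset.mem_filter] at hh
      rw [← mul_one (W h), ← hf h hh.2, Finset.mul_sum]
      refine Finset.sum_bij (fun a _ => h ++ [a.1]) ?_ ?_ ?_ ?_
      · intro a _
        simpa using a.2
      · intro a _ b _ hab
        simpa [Subtype.ext_iff] using hab
      · intro l hl
        simp only [Finset.mem_filter, Finset.mem_erase] at hl
        obtain ⟨⟨hne, hl⟩, rfl⟩ := hl
        exact ⟨⟨l.getLast hne, by rwa [List.dropLast_append_getLast]⟩, Finset.mem_univ _,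
          List.dropLast_append_getLast hne⟩
      · intro a _
        exact (hW h a.1).symm
    · intro l hl
      obtain ⟨hne, hl⟩ := Finset.mem_erase.1 hl
      have hl' : l.dropLast ++ [l.getLast hne] ∈ T.hist := by rwa [List.dropLast_append_getLast]
      exact Finset.mem_filter.2 ⟨T.prefix_closed _ _ hl', _, hl'⟩
  have hterm : ∑ z : T.Terminal, W z.1 =
      ∑ h ∈ T.hist with ¬ ∃ a, h ++ [a] ∈ T.hist, W h := by
    refine Finset.sum_bij (fun z _ => z.1) ?_ ?_ ?_ ?_
    · intro z _
      simpa using z.2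
    · intro a _ b _ hab
      exact Subtype.ext hab
    · intro h hh
      exact ⟨⟨h, by simpa using hh⟩, Finset.mem_univ _, rfl⟩
    · intro z _
      rfl
  have hall := Finset.sum_filter_add_sum_filter_not T.hist (fun h => ∃ a, h ++ [a] ∈ T.hist) W
  rw [hnon, ← hterm, ← Finset.add_sum_erase T.hist W T.nil_mem] at hall
  have h1 : W [] = 1 := T.pathProb_nil _ _
  linarith

end GameTree

namespace GameTree.ChanceStrategy

variable {N A : Type*} {T : GameTree N A}

theorem sum_prob (κ : T.ChanceStrategy) (h : List A) (hh : ∃ a, h ++ [a] ∈ T.hist) :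
    ∑ a : T.Avail h, κ.prob h a.1 = 1 := by
  rw [← (κ ⟨h, hh⟩).2.2]
  exact Finset.sum_congr rfl fun a _ => dif_pos a.2

end GameTree.ChanceStrategy

namespace GameForm

variable {N A : Type*} {F : GameForm N A}

theorem BehaviorStrategy.prob_eq {i : N} (σ : F.BehaviorStrategy i) (d : F.Decision i) (a : A)
    (ha : d.1 ++ [a] ∈ F.hist) :
    BehaviorStrategy.prob σ d.1 a = (σ (F.infoOf d)).1 ⟨a, d, rfl, ha⟩ :=
  dif_pos ⟨ha, d.2.2⟩

theorem BehaviorStrategy.sum_prob {i : N} (σ : F.BehaviorStrategy i) (d : F.Decision i) :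
    ∑ a : F.Avail d.1, BehaviorStrategy.prob σ d.1 a.1 = 1 := by
  rw [← (σ (F.infoOf d)).2.2]
  refine Finset.sum_bij (fun a _ => ⟨a.1, d, rfl, a.2⟩) (fun _ _ => Finset.mem_univ _) ?_ ?_ ?_
  · intro a _ b _ hab
    simpa [Subtype.ext_iff] using hab
  · rintro ⟨a, d', hd, ha⟩ _
    exact ⟨⟨a, (F.info_avail i d' d (Quotient.exact hd) a).1 ha⟩, Finset.mem_univ _, rfl⟩
  · intro a _
    exact BehaviorStrategy.prob_eq σ d a.1 a.2

theorem BehaviorStrategy.reach_nil {i : N} (σ : F.BehaviorStrategy i) :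
    BehaviorStrategy.reach σ [] = 1 :=
  F.pathProb_nil _ _

theorem BehaviorStrategy.reach_append_of_player_ne {i : N} (σ : F.BehaviorStrategy i) {h : List A}
    (hi : F.player h ≠ some i) (a : A) :
    BehaviorStrategy.reach σ (h ++ [a]) = BehaviorStrategy.reach σ h := by
  unfold BehaviorStrategy.reach
  rw [GameTree.pathProb_append_singleton, if_neg (by simpa using hi), mul_one]

theorem BehaviorStrategy.reach_append_of_decision {i : N} (σ : F.BehaviorStrategy i)
    (d : F.Decision i) (a : A) (ha : d.1 ++ [a] ∈ F.hist) :
    BehaviorStrategy.reach σ (d.1 ++ [a]) =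
      BehaviorStrategy.reach σ d.1 * (σ (F.infoOf d)).1 ⟨a, d, rfl, ha⟩ := by
  unfold BehaviorStrategy.reach
  rw [GameTree.pathProb_append_singleton, if_pos (by simpa using d.2.2),
    BehaviorStrategy.prob_eq σ d a ha]

/-- In the game in which `i` and `j` follow `σ` and `τ` and chance acts everywhere else, the
probabilities of the terminal histories add up to one. -/
theorem sum_terminal_reach_mul_reach {i j : N} (hij : i ≠ j) (σ : F.BehaviorStrategy i)
    (τ : F.BehaviorStrategy j) (κ : F.ChanceStrategy) :
    ∑ z : F.Terminal, BehaviorStrategy.reach σ z.1 * BehaviorStrategy.reach τ z.1 *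
      F.pathProb {some i, some j}ᶜ (GameTree.ChanceStrategy.prob κ) z.1 = 1 := by
  let f : List A → A → ℝ := fun h a =>
    if F.player h = some i then BehaviorStrategy.prob σ h a
    else if F.player h = some j then BehaviorStrategy.prob τ h a
    else κ.prob h a
  rw [← F.sum_terminal_pathProb f]
  · refine Finset.sum_congr rfl fun z _ => ?_
    unfold BehaviorStrategy.reach GameTree.pathProb
    rw [← Finset.prod_mul_distrib, ← Finset.prod_mul_distrib]
    refine Finset.prod_congr rfl fun k _ => ?_
    by_cases h1 : F.player (z.1.take k) = some i
    · have h2 : F.player (z.1.take k) ≠ some j := by simpa [h1] using hij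
      simp [f, h1, hij]
    · by_cases h2 : F.player (z.1.take k) = some j
      · simp [f, h2, hij.symm]
      · simp [f, h1, h2]
  · intro h hh
    by_cases h1 : F.player h = some i
    · simpa [f, h1] using BehaviorStrategy.sum_prob σ ⟨h, hh, h1⟩
    · by_cases h2 : F.player h = some j
      · simpa [f, h2, hij.symm] using BehaviorStrategy.sum_prob τ ⟨h, hh, h2⟩
      · simpa [f, h1, h2] using κ.sum_prob h hh

/-! ### Kuhn's equivalence of mixed and behavior strategies -/

theorem ownPast_nil (i : N) : F.ownPast i [] = ∅ := by
  ext x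
  simp [ownPast]

theorem ownPast_append_of_player_ne {i : N} {h : List A} (hi : F.player h ≠ some i) (a : A) :
    F.ownPast i (h ++ [a]) = F.ownPast i h := by
  ext x
  simp only [ownPast, Set.mem_ofPred_eq, List.prefix_concat_iff]
  refine exists_congr fun d => and_congr_right fun _ => or_iff_right ?_
  intro he
  have hd : d.1 = h := (List.append_inj' he rfl).1
  exact hi (hd ▸ d.2.2)

theorem ownPast_append_of_decision {i : N} (d : F.Decision i) (a : A) :
    F.ownPast i (d.1 ++ [a]) = insert (F.infoOf d, a) (F.ownPast i d.1) := by
  ext ⟨I, b⟩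
  simp only [ownPast, Set.mem_ofPred_eq, List.prefix_concat_iff, Set.mem_insert_iff, Prod.mk.injEq]
  constructor
  · rintro ⟨e, he, h | h⟩
    · obtain ⟨h1, h2⟩ := List.append_inj' h rfl
      obtain rfl : e = d := Subtype.ext h1
      exact Or.inl ⟨he.symm, by simpa using h2⟩
    · exact Or.inr ⟨e, he, h⟩
  · rintro (⟨rfl, rfl⟩ | ⟨e, he, h⟩)
    · exact ⟨d, rfl, Or.inl rfl⟩
    · exact ⟨e, he, Or.inr h⟩

/-- Perfect recall excludes absent-mindedness: no information set is passed twice. -/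
theorem PerfectRecall.infoOf_notMem_ownPast (hF : F.PerfectRecall) {i : N} (d : F.Decision i)
    (a : A) : (F.infoOf d, a) ∉ F.ownPast i d.1 := by
  -- Equal own pasts would yield ever shorter histories in the information set.
  induction hn : d.1.length using Nat.strong_induction_on generalizing d with
  | _ n ih =>
    rintro ⟨e, he, hp⟩
    have hlt : e.1.length < n := by
      have := hp.length_le
      simp at this
      omega
    refine ih _ hlt e rfl ?_
    rw [hF i e d he, show F.infoOf e = F.infoOf d from he]
    exact ⟨e, he, hp⟩

variable (F) in
/-- The action `a` at `I` agrees with everything that player `i` has done at `I` before `h`; this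
holds vacuously if the path to `h` does not pass `I`. -/
def ConsistentAt (i : N) (h : List A) (I : F.InfoSet i) (a : A) : Prop :=
  ∀ b, (I, b) ∈ F.ownPast i h → a = b

noncomputable instance (i : N) : Fintype (F.InfoSet i) := Fintype.ofFinite _

/-- Under perfect recall every information set on a path contributes a single factor to the
probability of the path, so this probability is a product over all information sets. -/
theorem BehaviorStrategy.reach_eq_prod (hF : F.PerfectRecall) {i : N} (σ : F.BehaviorStrategy i)
    {h : List A} (hh : h ∈ F.hist) :
    BehaviorStrategy.reach σ h = ∏ I : F.InfoSet i, ∑ a : ActionsAt I,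
      (σ I).1 a * if F.ConsistentAt i h I a.1 then 1 else 0 := by
  induction h using List.reverseRecOn with
  | nil =>
    rw [reach_nil]
    refine (Finset.prod_eq_one fun I _ => ?_).symm
    simpa [ConsistentAt, ownPast_nil] using (σ I).2.2
  | append_singleton h a ih =>
    have ih := ih (F.prefix_closed h a hh)
    by_cases hi : F.player h = some i
    · obtain ⟨d, rfl⟩ : ∃ d : F.Decision i, d.1 = h := ⟨⟨h, ⟨a, hh⟩, hi⟩, rfl⟩
      rw [reach_append_of_decision σ d a hh, ih,
        ← Finset.prod_erase_mul _ _ (Finset.mem_univ (F.infoOf d)),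
        ← Finset.prod_erase_mul _ _ (Finset.mem_univ (F.infoOf d))]
      have hnew : ∀ c, F.ConsistentAt i d.1 (F.infoOf d) c := fun c b hb =>
        (hF.infoOf_notMem_ownPast d b hb).elim
      have hold : ∀ c, F.ConsistentAt i (d.1 ++ [a]) (F.infoOf d) c ↔ c = a := fun c => by
        constructor
        · intro hc
          exact hc a (by simp [ownPast_append_of_decision])
        · rintro rfl b hb
          rw [ownPast_append_of_decision] at hb
          rcases hb with hb | hb
          · exact (congrArg Prod.snd hb).symm
          · exact (hF.infoOf_notMem_ownPast d b hb).elim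
      have hsum : ∑ c : ActionsAt (F.infoOf d), (σ (F.infoOf d)).1 c = 1 := (σ (F.infoOf d)).2.2
      simp only [hnew, hold, if_true, mul_one, hsum]
      congr 1
      · refine Finset.prod_congr rfl fun I hI => ?_
        have hne := Finset.ne_of_mem_erase hI
        have hsame : ∀ c, F.ConsistentAt i (d.1 ++ [a]) I c ↔ F.ConsistentAt i d.1 I c := fun c => by
          simp [ConsistentAt, ownPast_append_of_decision, hne]
        simp only [hsame]
      · rw [Finset.sum_eq_single_of_mem (⟨a, d, rfl, hh⟩ : ActionsAt (F.infoOf d))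
          (Finset.mem_univ _)]
        · simp
        · intro c _ hc
          rw [if_neg fun h => hc (Subtype.ext h), mul_zero]
    · rw [reach_append_of_player_ne σ hi, ih]
      have hsame : ∀ I c, F.ConsistentAt i (h ++ [a]) I c ↔ F.ConsistentAt i h I c := fun I c => by
        simp only [ConsistentAt, ownPast_append_of_player_ne hi]
      simp only [hsame]

theorem PureStrategy.reach_toBehavior_eq_prod (hF : F.PerfectRecall) {i : N}
    (ρ : F.PureStrategy i) {h : List A} (hh : h ∈ F.hist) :
    BehaviorStrategy.reach (PureStrategy.toBehavior ρ) h =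
      ∏ I : F.InfoSet i, if F.ConsistentAt i h I (ρ I).1 then 1 else 0 := by
  rw [BehaviorStrategy.reach_eq_prod hF _ hh]
  refine Finset.prod_congr rfl fun I _ => ?_
  rw [Finset.sum_eq_single_of_mem (ρ I) (Finset.mem_univ _)]
  · simp [PureStrategy.toBehavior]
  · intro c _ hc
    simp [PureStrategy.toBehavior, hc]

theorem PureStrategy.reach_toBehavior (hF : F.PerfectRecall) {i : N}
    (ρ : F.PureStrategy i) {h : List A} (hh : h ∈ F.hist) :
    BehaviorStrategy.reach (PureStrategy.toBehavior ρ) h =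
      if ∀ I, F.ConsistentAt i h I (ρ I).1 then 1 else 0 := by
  rw [PureStrategy.reach_toBehavior_eq_prod hF ρ hh, Finset.prod_boole]
  simp

/-- The mixed strategy that chooses independently at every information set as `σ` does. -/
noncomputable def BehaviorStrategy.mixed {i : N} (σ : F.BehaviorStrategy i)
    (ρ : F.PureStrategy i) : ℝ :=
  ∏ I, (σ I).1 (ρ I)

theorem BehaviorStrategy.mixed_nonneg {i : N} (σ : F.BehaviorStrategy i) (ρ : F.PureStrategy i) :
    0 ≤ BehaviorStrategy.mixed σ ρ :=
  Finset.prod_nonneg fun I _ => (σ I).2.1 _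

/-- Expectations of products over the information sets factor, by independence. -/
theorem BehaviorStrategy.sum_mixed_mul_prod {i : N} (σ : F.BehaviorStrategy i)
    (g : ∀ I : F.InfoSet i, ActionsAt I → ℝ) :
    ∑ ρ, BehaviorStrategy.mixed σ ρ * ∏ I, g I (ρ I) =
      ∏ I, ∑ a : ActionsAt I, (σ I).1 a * g I a := by
  rw [Finset.prod_univ_sum]
  simp only [BehaviorStrategy.mixed, ← Finset.prod_mul_distrib]
  refine Finset.sum_congr ?_ fun _ _ => rfl
  ext ρ
  simp

theorem BehaviorStrategy.sum_mixed {i : N} (σ : F.BehaviorStrategy i) :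
    ∑ ρ, BehaviorStrategy.mixed σ ρ = 1 := by
  have h := BehaviorStrategy.sum_mixed_mul_prod σ fun _ _ => 1
  simp only [Finset.prod_const_one, mul_one] at h
  rw [h]
  exact Finset.prod_eq_one fun I _ => (σ I).2.2

/-- Under perfect recall a behavior strategy reaches every history with the same probability as its
mixed strategy. -/
theorem BehaviorStrategy.sum_mixed_mul_reach (hF : F.PerfectRecall) {i : N}
    (σ : F.BehaviorStrategy i) {h : List A} (hh : h ∈ F.hist) :
    ∑ ρ, BehaviorStrategy.mixed σ ρ * BehaviorStrategy.reach (PureStrategy.toBehavior ρ) h =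
      BehaviorStrategy.reach σ h := by
  rw [BehaviorStrategy.reach_eq_prod hF σ hh, ← BehaviorStrategy.sum_mixed_mul_prod]
  exact Finset.sum_congr rfl fun ρ _ => by rw [PureStrategy.reach_toBehavior_eq_prod hF ρ hh]

/-- Under perfect recall a pure strategy reaches either all or none of the histories of an
information set, as far as the actions of its own player are concerned. -/
theorem mem_playTo (hF : F.PerfectRecall) {i : N} (d : F.Decision i) (ρ : F.PureStrategy i) :
    ρ ∈ playTo (F.infoOf d) ↔ BehaviorStrategy.reach (PureStrategy.toBehavior ρ) d.1 = 1 := by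
  have hist : ∀ e : F.Decision i, e.1 ∈ F.hist := fun e =>
    e.2.1.elim fun a ha => F.prefix_closed _ a ha
  simp only [playTo, Finset.mem_filter, Finset.mem_univ, true_and]
  refine ⟨?_, fun h => ⟨d, rfl, h⟩⟩
  rintro ⟨e, he, h⟩
  have hsame : ∀ I c, F.ConsistentAt i e.1 I c ↔ F.ConsistentAt i d.1 I c := fun I c => by
    simp only [ConsistentAt, hF i e d he]
  rw [PureStrategy.reach_toBehavior hF ρ (hist _)] at h ⊢
  simpa only [hsame] using h

section Marginal

variable [Fintype N] [DecidableEq N]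

theorem marginal_nonneg {μ : F.PureProfile → ℝ} (hμ : ∀ ρ, 0 ≤ μ ρ) (i : N)
    (ρi : F.PureStrategy i) : 0 ≤ marginal μ i ρi :=
  Finset.sum_nonneg fun ρ _ => hμ ρ

theorem sum_marginal_mul (μ : F.PureProfile → ℝ) (i : N) (f : F.PureStrategy i → ℝ) :
    ∑ ρi, marginal μ i ρi * f ρi = ∑ ρ : F.PureProfile, μ ρ * f (ρ i) := by
  simp only [marginal, Finset.sum_filter, Finset.sum_mul]
  rw [Finset.sum_comm]
  refine Finset.sum_congr rfl fun ρ _ => ?_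
  simp [ite_mul]

/-- Under perfect recall the marginal behavior strategies reach every history with the same
probability as the marginals of `μ`. -/
theorem IsMarginalBehavior.reach_eq (hF : F.PerfectRecall) {μ : F.PureProfile → ℝ}
    (hμ : μ ∈ stdSimplex ℝ F.PureProfile) {π : F.BehaviorProfile} (hπ : IsMarginalBehavior μ π)
    (i : N) {h : List A} (hh : h ∈ F.hist) :
    ∑ ρ : F.PureProfile, μ ρ * BehaviorStrategy.reach (PureStrategy.toBehavior (ρ i)) h =
      BehaviorStrategy.reach (π i) h := by
  rw [← sum_marginal_mul μ i fun ρi => BehaviorStrategy.reach (PureStrategy.toBehavior ρi) h]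
  induction h using List.reverseRecOn with
  | nil =>
    have h1 := sum_marginal_mul μ i fun _ => 1
    simp only [mul_one, hμ.2] at h1
    simp only [BehaviorStrategy.reach_nil, mul_one, h1]
  | append_singleton h a ih =>
    have hh' := F.prefix_closed h a hh
    have ih := ih hh'
    by_cases hi : F.player h = some i
    · obtain ⟨d, rfl⟩ : ∃ d : F.Decision i, d.1 = h := ⟨⟨h, ⟨a, hh⟩, hi⟩, rfl⟩
      simp only [BehaviorStrategy.reach_append_of_decision _ d a hh]
      set a' : ActionsAt (F.infoOf d) := ⟨a, d, rfl, hh⟩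
      have hreach : ∀ ρi : F.PureStrategy i,
          BehaviorStrategy.reach (PureStrategy.toBehavior ρi) d.1 =
            if ρi ∈ playTo (F.infoOf d) then 1 else 0 := fun ρi => by
        have hmem := mem_playTo hF d ρi
        split_ifs with h
        · exact hmem.1 h
        · rw [PureStrategy.reach_toBehavior hF ρi hh'] at hmem ⊢
          exact if_neg fun hc => h (hmem.2 (if_pos hc))
      have hden : ∑ ρi ∈ playTo (F.infoOf d), marginal μ i ρi = BehaviorStrategy.reach (π i) d.1 := by
        rw [← ih]
        simp [hreach]
      have hnum : ∑ ρi ∈ playToAction (F.infoOf d) a', marginal μ i ρi =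
          ∑ ρi, marginal μ i ρi * (BehaviorStrategy.reach (PureStrategy.toBehavior ρi) d.1 *
            (PureStrategy.toBehavior ρi (F.infoOf d)).1 a') := by
        have hact : ∀ ρi : F.PureStrategy i, (PureStrategy.toBehavior ρi (F.infoOf d)).1 a' =
            if ρi (F.infoOf d) = a' then 1 else 0 := fun ρi => by
          simp [PureStrategy.toBehavior, Pi.single_apply, eq_comm (a := a')]
        rw [playToAction, Finset.sum_filter, ← Finset.univ_inter (playTo _), ← Finset.sum_ite_mem]
        refine Finset.sum_congr rfl fun ρi _ => ?_
        rw [hreach, hact, ite_zero_mul_ite_zero, one_mul, mul_ite, mul_one, mul_zero, ite_and]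
      rw [← hnum]
      by_cases h0 : ∑ ρi ∈ playTo (F.infoOf d), marginal μ i ρi = 0
      · -- `π` is arbitrary here, but neither side reaches the information set.
        rw [← hden, h0, zero_mul]
        have hz := (Finset.sum_eq_zero_iff_of_nonneg
          fun ρi _ => marginal_nonneg hμ.1 i ρi).1 h0
        exact Finset.sum_eq_zero fun ρi hρ => hz ρi (Finset.mem_filter.1 hρ).1
      · rw [hπ i _ h0 a', ← hden, mul_div_cancel₀ _ h0]
    · simpa only [BehaviorStrategy.reach_append_of_player_ne _ hi] using ih

end Marginal

end GameForm

/-! ### Polymatrix games -/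

namespace PolyEFG

variable {N A : Type*} {F : GameForm N A} (P : PolyEFG F)

/-- The utility in an edge game is linear in the reach probabilities of the first player: a strategy
that reaches every history as the mixture of the `σs k` with weights `w k` does has the mixed
utility. -/
theorem edgeUtility_eq_sum_left {ι : Type*} (s : Finset ι) (i j : N) (w : ι → ℝ)
    (σs : ι → F.BehaviorStrategy i) (σ : F.BehaviorStrategy i) (τ : F.BehaviorStrategy j)
    (hσ : ∀ h ∈ F.hist, ∑ k ∈ s, w k * GameForm.BehaviorStrategy.reach (σs k) h =
      GameForm.BehaviorStrategy.reach σ h) :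
    P.edgeUtility i j σ τ = ∑ k ∈ s, w k * P.edgeUtility i j (σs k) τ := by
  simp only [edgeUtility, Finset.mul_sum]
  rw [Finset.sum_comm]
  refine Finset.sum_congr rfl fun z _ => ?_
  rw [← hσ z.1 z.2.1]
  simp only [Finset.sum_mul, mul_assoc]

/-- The counterpart of `edgeUtility_eq_sum_left` for the second player. -/
theorem edgeUtility_eq_sum_right {ι : Type*} (s : Finset ι) (i j : N) (w : ι → ℝ)
    (τs : ι → F.BehaviorStrategy j) (σ : F.BehaviorStrategy i) (τ : F.BehaviorStrategy j)
    (hτ : ∀ h ∈ F.hist, ∑ k ∈ s, w k * GameForm.BehaviorStrategy.reach (τs k) h =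
      GameForm.BehaviorStrategy.reach τ h) :
    P.edgeUtility i j σ τ = ∑ k ∈ s, w k * P.edgeUtility i j σ (τs k) := by
  simp only [edgeUtility, Finset.mul_sum]
  rw [Finset.sum_comm]
  refine Finset.sum_congr rfl fun z _ => ?_
  rw [← hτ z.1 z.2.1]
  simp only [Finset.sum_mul, Finset.mul_sum]
  exact Finset.sum_congr rfl fun k _ => by ring

/-- A constant sum at the terminal histories is a constant sum of expected utilities, because the
terminal histories have total probability one. -/
theorem IsConstantSum.exists_edgeUtility_add (hP : P.IsConstantSum) {i j : N}
    (hij : P.graph.Adj i j) :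
    ∃ c : ℝ, ∀ (σ : F.BehaviorStrategy i) (τ : F.BehaviorStrategy j),
      P.edgeUtility i j σ τ + P.edgeUtility j i τ σ = c := by
  obtain ⟨c, hc⟩ := hP i j hij
  refine ⟨c, fun σ τ => ?_⟩
  rw [← one_mul c, ← GameForm.sum_terminal_reach_mul_reach hij.ne σ τ (P.chance s(i, j)),
    edgeUtility, edgeUtility, Finset.sum_mul, ← Finset.sum_add_distrib]
  refine Finset.sum_congr rfl fun z _ => ?_
  rw [← hc z, Sym2.eq_swap (a := j), Set.pair_comm (some j)]
  ring

section Players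

variable [Fintype N]

theorem numEdges_eq_card (i : N) :
    P.numEdges i = (Finset.univ.filter fun j => P.graph.Adj i j).card := by
  rw [numEdges, Set.ncard_eq_toFinset_card', Set.toFinset_card,
    SimpleGraph.card_incidenceSet_eq_degree, ← SimpleGraph.card_neighborFinset_eq_degree,
    SimpleGraph.neighborFinset_eq_filter]

theorem numEdges_add_one_le (i : N) : P.numEdges i + 1 ≤ Fintype.card N := by
  rw [numEdges_eq_card]
  refine Finset.card_lt_univ_of_notMem (x := i) ?_
  simp

theorem IsConstantSum.exists_sum_expUtility (hP : P.IsConstantSum) :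
    ∃ C : ℝ, ∀ π : F.BehaviorProfile, ∑ i, P.expUtility i π = C := by
  have h : ∀ i j, ∃ c : ℝ, P.graph.Adj i j → ∀ (σ : F.BehaviorStrategy i)
      (τ : F.BehaviorStrategy j), P.edgeUtility i j σ τ + P.edgeUtility j i τ σ = c := fun i j => by
    by_cases hij : P.graph.Adj i j
    · obtain ⟨c, hc⟩ := hP.exists_edgeUtility_add P hij
      exact ⟨c, fun _ => hc⟩
    · exact ⟨0, fun h => (hij h).elim⟩
  choose c hc using h
  refine ⟨(∑ i, ∑ j, if P.graph.Adj i j then c i j else 0) / 2, fun π => ?_⟩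
  -- Twice the total counts every edge game once from either side.
  have hswap : ∑ i, P.expUtility i π =
      ∑ i, ∑ j, if P.graph.Adj i j then P.edgeUtility j i (π j) (π i) else 0 := by
    simp only [expUtility, Finset.sum_filter]
    rw [Finset.sum_comm]
    simp only [P.graph.adj_comm]
  have hdouble : ∑ i, P.expUtility i π + ∑ i, P.expUtility i π =
      ∑ i, ∑ j, if P.graph.Adj i j then c i j else 0 := by
    conv_lhs => arg 2; rw [hswap]
    simp only [expUtility, Finset.sum_filter, ← Finset.sum_add_distrib]
    refine Finset.sum_congr rfl fun i _ => Finset.sum_congr rfl fun j _ => ?_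
    split_ifs with hij
    · exact hc i j hij _ _
    · exact add_zero 0
  linarith

variable [DecidableEq N]

theorem expUtility_update (i : N) (π : F.BehaviorProfile) (σ : F.BehaviorStrategy i) :
    P.expUtility i (Function.update π i σ) =
      ∑ j with P.graph.Adj i j, P.edgeUtility i j σ (π j) := by
  refine Finset.sum_congr rfl fun j hj => ?_
  have hij : P.graph.Adj i j := (Finset.mem_filter.1 hj).2
  rw [Function.update_self, Function.update_of_ne hij.ne']

/-- The opponents of `i` affect the utility of `i` only through their marginals, because every edge
game is linear in the reach probabilities of the opponent. -/
theorem expUtility_update_eq_sum_profile (hF : F.PerfectRecall) {μ : F.PureProfile → ℝ}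
    (hμ : μ ∈ stdSimplex ℝ F.PureProfile) {π : F.BehaviorProfile}
    (hπ : GameForm.IsMarginalBehavior μ π) (i : N) (σ : F.BehaviorStrategy i) :
    P.expUtility i (Function.update π i σ) =
      ∑ ρ, μ ρ * P.expUtility i (Function.update (GameForm.PureProfile.toBehavior ρ) i σ) := by
  simp only [expUtility_update, Finset.mul_sum]
  rw [Finset.sum_comm]
  exact Finset.sum_congr rfl fun j _ => P.edgeUtility_eq_sum_right _ _ _ _ _ _ _ fun h hh =>
    hπ.reach_eq hF hμ j hh

theorem expUtility_update_eq_sum_mixed (hF : F.PerfectRecall) (π : F.BehaviorProfile) (i : N)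
    (σ : F.BehaviorStrategy i) :
    P.expUtility i (Function.update π i σ) =
      ∑ ρ, GameForm.BehaviorStrategy.mixed σ ρ *
        P.expUtility i (Function.update π i (GameForm.PureStrategy.toBehavior ρ)) := by
  simp only [expUtility_update, Finset.mul_sum]
  rw [Finset.sum_comm]
  exact Finset.sum_congr rfl fun j _ => P.edgeUtility_eq_sum_left _ _ _ _ _ _ _ fun h hh =>
    GameForm.BehaviorStrategy.sum_mixed_mul_reach hF σ hh

/-- Changing the strategies of the opponents of `i` costs `i` at most `γ` on every edge: in a
constant-sum edge game the loss of `i` is the gain of the opponent. -/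
theorem IsStableProfile.expUtility_sub_le (hP : P.IsConstantSum) {γ : ℝ} {π : F.BehaviorProfile}
    (hπ : P.IsStableProfile γ π) (i : N) (π' : F.BehaviorProfile) :
    P.expUtility i π - P.expUtility i (Function.update π' i (π i)) ≤ P.numEdges i * γ := by
  rw [expUtility_update, expUtility, ← Finset.sum_sub_distrib, numEdges_eq_card, ← nsmul_eq_mul]
  refine Finset.sum_le_card_nsmul _ _ _ fun j hj => ?_
  have hij : P.graph.Adj i j := (Finset.mem_filter.1 hj).2
  obtain ⟨c, hc⟩ := hP.exists_edgeUtility_add P hij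
  linarith [hc (π i) (π j), hc (π i) (π' j), (hπ i j hij).2 (π' j)]

end Players

end PolyEFG

/-! ### Coarse correlated equilibria -/

namespace EFG

variable {N A : Type*} [Fintype N] [DecidableEq N] (G : EFG N A)

/-- Passing to `P` and back costs `δ` each, so in `P` no deviation from the marginal profile gives
more than `2 * δ` above the expected utility under `μ`. -/
theorem IsCCE.expUtility_update_le (hF : G.PerfectRecall) {δ : ℝ} {P : PolyEFG G.toGameForm}
    (hP : P ∈ G.CSP δ) {μ : G.PureProfile → ℝ} (hμ : G.IsCCE μ) {π : G.BehaviorProfile}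
    (hπ : GameForm.IsMarginalBehavior μ π) (i : N) (σ : G.BehaviorStrategy i) :
    P.expUtility i (Function.update π i σ) ≤
      ∑ ρ, μ ρ * P.expUtility i (GameForm.PureProfile.toBehavior ρ) + 2 * δ := by
  have hpure : ∀ ρi : G.PureStrategy i,
      P.expUtility i (Function.update π i (GameForm.PureStrategy.toBehavior ρi)) ≤
        ∑ ρ, μ ρ * P.expUtility i (GameForm.PureProfile.toBehavior ρ) + 2 * δ := fun ρi => by
    have hupd : ∀ ρ : G.PureProfile, GameForm.PureProfile.toBehavior (Function.update ρ i ρi) =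
        Function.update (GameForm.PureProfile.toBehavior ρ) i
          (GameForm.PureStrategy.toBehavior ρi) := fun ρ => by
      funext j
      rcases eq_or_ne j i with rfl | hj
      · simp [GameForm.PureProfile.toBehavior]
      · simp [GameForm.PureProfile.toBehavior, hj]
    have hclose : ∑ ρ, μ ρ *
        (P.expUtility i (Function.update (GameForm.PureProfile.toBehavior ρ) i
            (GameForm.PureStrategy.toBehavior ρi)) -
          P.expUtility i (GameForm.PureProfile.toBehavior ρ)) ≤
        ∑ ρ, (μ ρ * (G.expUtility i (GameForm.PureProfile.toBehavior (Function.update ρ i ρi)) -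
          G.expUtility i (GameForm.PureProfile.toBehavior ρ)) + μ ρ * (2 * δ)) := by
      refine Finset.sum_le_sum fun ρ _ => ?_
      rw [← mul_add, ← hupd]
      refine mul_le_mul_of_nonneg_left ?_ (hμ.1.1 ρ)
      have h1 := abs_le.1 (hP.2 i (GameForm.PureProfile.toBehavior ρ))
      have h2 := abs_le.1 (hP.2 i (GameForm.PureProfile.toBehavior (Function.update ρ i ρi)))
      linarith [h1.1, h1.2, h2.1, h2.2]
    rw [Finset.sum_add_distrib, ← Finset.sum_mul, hμ.1.2, one_mul] at hclose
    simp only [mul_sub, Finset.sum_sub_distrib] at hclose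
    rw [P.expUtility_update_eq_sum_profile hF hμ.1 hπ]
    have hdev := hμ.2 i ρi
    simp only [mul_sub, Finset.sum_sub_distrib] at hdev
    linarith
  rw [P.expUtility_update_eq_sum_mixed hF]
  refine (Finset.sum_le_sum fun ρi _ => mul_le_mul_of_nonneg_left (hpure ρi)
    (GameForm.BehaviorStrategy.mixed_nonneg σ ρi)).trans ?_
  rw [← Finset.sum_mul, GameForm.BehaviorStrategy.sum_mixed, one_mul]

/-- The marginal profile of a coarse correlated equilibrium is an approximate Nash equilibrium of
every constant-sum polymatrix game close to `G`. -/
theorem IsCCE.isNash (hF : G.PerfectRecall) {δ : ℝ} {P : PolyEFG G.toGameForm}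
    (hP : P ∈ G.CSP δ) {μ : G.PureProfile → ℝ} (hμ : G.IsCCE μ) {π : G.BehaviorProfile}
    (hπ : GameForm.IsMarginalBehavior μ π) :
    P.IsNash (2 * (Fintype.card N : ℝ) * δ) π := by
  intro i σ
  obtain ⟨C, hC⟩ := hP.1.exists_sum_expUtility P
  set U : N → ℝ := fun j => ∑ ρ, μ ρ * P.expUtility j (GameForm.PureProfile.toBehavior ρ)
  have hU : ∑ j, U j = C := by
    simp only [U]
    rw [Finset.sum_comm]
    simp only [← Finset.mul_sum, hC, ← Finset.sum_mul, hμ.1.2, one_mul]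
  have hi : P.expUtility i (Function.update π i σ) ≤ U i + 2 * δ :=
    hμ.expUtility_update_le G hF hP hπ i σ
  have hothers : ∑ j ∈ Finset.univ.erase i, P.expUtility j π ≤
      ∑ j ∈ Finset.univ.erase i, (U j + 2 * δ) := Finset.sum_le_sum fun j _ => by
    have hj := hμ.expUtility_update_le G hF hP hπ j (π j)
    rwa [Function.update_eq_self] at hj
  -- Both totals equal `C`: as the other players lose little against `U`, player `i` gains little.
  rw [Finset.sum_add_distrib, Finset.sum_const, nsmul_eq_mul,
    Finset.cast_card_erase_of_mem (Finset.mem_univ i), Finset.card_univ] at hothers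
  have hπC := hC π
  rw [← Finset.add_sum_erase _ _ (Finset.mem_univ i)] at hU hπC
  linarith

end EFG

theorem mainTheorem6 {N A : Type*} [Fintype N] [DecidableEq N] (G : EFG N A)
    (hrecall : G.PerfectRecall) (δ γ : ℝ)
    (P : PolyEFG G.toGameForm) (hP : P ∈ G.CSP δ)
    (hstable : P.IsSubgameStable (2 * (Fintype.card N : ℝ) * δ) γ)
    (μ : G.PureProfile → ℝ) (hμ : G.IsCCE μ)
    (π : G.BehaviorProfile) (hπ : GameForm.IsMarginalBehavior μ π) (i : N) :
    G.vulnerability i π Set.univ ≤ (P.numEdges i : ℝ) * γ + 2 * δ ∧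
    (0 ≤ γ →
      (P.numEdges i : ℝ) * γ + 2 * δ ≤ ((Fintype.card N : ℝ) - 1) * γ + 2 * δ) := by
  constructor
  · have hs := hstable π (hμ.isNash G hrecall hP hπ)
    obtain ⟨π', -, hπ'⟩ := (G.isLeast_sInf_payoffsAgainst i π).1
    rw [EFG.vulnerability, ← hπ']
    have h1 := (abs_le.1 (hP.2 i π)).2
    have h2 := (abs_le.1 (hP.2 i (Function.update π' i (π i)))).1
    have h3 := hs.expUtility_sub_le P hP.1 i π'
    simp only
    linarith
  · intro hγ
    have h : (P.numEdges i : ℝ) + 1 ≤ Fintype.card N := mod_cast P.numEdges_add_one_le i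
    have := mul_le_mul_of_nonneg_right (le_sub_iff_add_le.2 h) hγ
    linarith
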